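/- Let $a,b$ be square-free integers such that $\mathbb{Q}(\sqrt a)$ and $\mathbb{Q}(\sqrt b)$ are quadratic fields and $ab$ is not a square. Put $c=ab/\gcd(a,b)^2$, $\sqrt c=\sqrt a\sqrt b/\gcd(a,b)$, $F_1=\mathbb{Q}(\sqrt a)$, $F_2=\mathbb{Q}(\sqrt b)$, $F_3=\mathbb{Q}(\sqrt c)$ and $F=\mathbb{Q}(\sqrt a,\sqrt b)$, and for $i\in\{1,2\}$ let $\sigma_i$ be the non-identity element of $\mathrm{Gal}(F/\mathbb{Q})$ that fixes $F_i$. Let $S=s_0+s_1\sqrt a+s_2\sqrt b+s_3\sqrt c\neq 0$ with $s_0,s_1,s_2,s_3\in\mathbb{Z}$. Let $p\equiv 3\pmod 4$ be a prime dividing $N_{F/\mathbb{Q}}(S)$, with $p\mid a$, $p\mid b$ and Legendre symbol $\left(\frac{c}{p}\right)=1$. Let $C$ be an integer with $C^2\equiv c\pmod p$, and consider the prime ideals $\mathfrak p_1=(p,\sqrt a)$ of $O_{F_1}$, $\mathfrak p_2=(p,\sqrt b)$ of $O_{F_2}$ and $\mathfrak p_{3i}=(p,\sqrt c+(-1)^iC)$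 of $O_{F_3}$ for $i\in\{1,2\}$. For a prime ideal $\mathfrak p$ let $v_{\mathfrak p}(x)$ be the exponent of $\mathfrak p$ in the factorization of the principal ideal $(x)$. For a prime $\mathcal P$ of $F$ let $\left(\frac{-1,S}{\mathcal P}\right)$ be the Hilbert symbol in the completion $F_{\mathcal P}$: it is $1$ if $-\xi^2+S\eta^2=1$ is solvable in $F_{\mathcal P}$, and $-1$ otherwise. Then $F$ has exactly two $p$-adic places $\mathcal P$, and $\left(\frac{-1,S}{\mathcal P}\right)=1$ for both of them if and only if $$v_{\mathfrak p_1}(S\sigma_1(S))+v_{\mathfrak p_2}(S\sigma_2(S))-2\,v_{\mathfrak p_{3i}}(\sigma_1(S)\sigma_2(S))$$ is divisible by $4$ for both $i=1$ and $i=2$. -/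

import Mathlib

open NumberField IsDedekindDomain

/-- A biquadratic field `F = ℚ(√a, √b)`: `a` and `b` are square-free integers such that `ℚ(√a)` and
`ℚ(√b)` are quadratic and `ab` is not a square, `sqrtA`, `sqrtB` are the chosen square roots, and
`σ₁`, `σ₂` are the nontrivial automorphisms of `F` that fix `ℚ(√a)`, respectively `ℚ(√b)`. -/
structure BiquadraticField (F : Type*) [Field F] [NumberField F] where
  a : ℤ
  b : ℤ
  squarefree_a : Squarefree a
  squarefree_b : Squarefree b
  a_ne_one : a ≠ 1
  b_ne_one : b ≠ 1
  not_isSquare : ¬ IsSquare (a * b)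
  sqrtA : F
  sqrtB : F
  sq_sqrtA : sqrtA ^ 2 = (a : F)
  sq_sqrtB : sqrtB ^ 2 = (b : F)
  adjoin_eq_top : IntermediateField.adjoin ℚ {sqrtA, sqrtB} = ⊤
  σ₁ : F ≃ₐ[ℚ] F
  σ₂ : F ≃ₐ[ℚ] F
  σ₁_ne_one : σ₁ ≠ 1
  σ₂_ne_one : σ₂ ≠ 1
  σ₁_sqrtA : σ₁ sqrtA = sqrtA
  σ₂_sqrtB : σ₂ sqrtB = sqrtB

namespace BiquadraticField

variable {F : Type*} [Field F] [NumberField F] (D : BiquadraticField F)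

/-- `c = ab / gcd(a, b)²` (the division is exact). -/
def c : ℤ := D.a * D.b / (Int.gcd D.a D.b : ℤ) ^ 2

/-- The square root `√c = √a √b / gcd(a, b)` of `c`. -/
noncomputable def sqrtC : F := D.sqrtA * D.sqrtB / (Int.gcd D.a D.b : F)

/-- `F₁ = ℚ(√a)`. -/
noncomputable def F₁ : IntermediateField ℚ F := IntermediateField.adjoin ℚ {D.sqrtA}

/-- `F₂ = ℚ(√b)`. -/
noncomputable def F₂ : IntermediateField ℚ F := IntermediateField.adjoin ℚ {D.sqrtB}

/-- `F₃ = ℚ(√c)`. -/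
noncomputable def F₃ : IntermediateField ℚ F := IntermediateField.adjoin ℚ {D.sqrtC}

/-- The number `S = s₀ + s₁√a + s₂√b + s₃√c`. -/
noncomputable def elt (s : Fin 4 → ℤ) : F :=
  (s 0 : F) + (s 1 : F) * D.sqrtA + (s 2 : F) * D.sqrtB + (s 3 : F) * D.sqrtC

theorem gcd_ne_zero : (Int.gcd D.a D.b : F) ≠ 0 := by
  have h : D.a ≠ 0 := D.squarefree_a.ne_zero
  have : Int.gcd D.a D.b ≠ 0 := fun h0 => h (Int.gcd_eq_zero_iff.mp h0).1
  exact_mod_cast this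

theorem gcd_mul_sqrtC : (Int.gcd D.a D.b : F) * D.sqrtC = D.sqrtA * D.sqrtB := by
  unfold sqrtC
  field_simp [D.gcd_ne_zero]

theorem sq_sqrtC : D.sqrtC ^ 2 = (D.c : F) := by
  have hd : ((Int.gcd D.a D.b : ℤ)) ^ 2 ∣ D.a * D.b := by
    rw [sq]
    exact mul_dvd_mul (Int.gcd_dvd_left ..) (Int.gcd_dvd_right ..)
  have h1 : D.c * (Int.gcd D.a D.b : ℤ) ^ 2 = D.a * D.b := Int.ediv_mul_cancel hd
  have h2 : (D.c : F) * (Int.gcd D.a D.b : F) ^ 2 = (D.a : F) * (D.b : F) := by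
    exact_mod_cast congrArg (Int.cast : ℤ → F) h1
  have hg := D.gcd_ne_zero
  apply mul_right_cancel₀ (pow_ne_zero 2 hg)
  rw [h2, ← D.sq_sqrtA, ← D.sq_sqrtB, ← mul_pow, mul_comm D.sqrtC, D.gcd_mul_sqrtC, mul_pow]

theorem isIntegral_of_sq {x : F} {n : ℤ} (h : x ^ 2 = (n : F)) : IsIntegral ℤ x := by
  apply IsIntegral.of_pow (n := 2) (by norm_num)
  rw [h]
  exact isIntegral_algebraMap (R := ℤ) (x := n)

theorem isIntegral_elt (s : Fin 4 → ℤ) : IsIntegral ℤ (D.elt s) := by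
  have hi : ∀ n : ℤ, IsIntegral ℤ (n : F) := fun n => isIntegral_algebraMap (R := ℤ) (x := n)
  exact (((hi _).add ((hi _).mul (isIntegral_of_sq D.sq_sqrtA))).add
    ((hi _).mul (isIntegral_of_sq D.sq_sqrtB))).add ((hi _).mul (isIntegral_of_sq D.sq_sqrtC))

theorem isIntegral_map (σ : F ≃ₐ[ℚ] F) {x : F} (h : IsIntegral ℤ x) : IsIntegral ℤ (σ x) :=
  h.map (σ.toAlgHom.restrictScalars ℤ)

theorem eq_one_of_fixes {σ : F ≃ₐ[ℚ] F} (hA : σ D.sqrtA = D.sqrtA) (hB : σ D.sqrtB = D.sqrtB) :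
    σ = 1 := by
  have h : (IntermediateField.adjoin ℚ {D.sqrtA, D.sqrtB}) ≤
      IntermediateField.fixedField (Subgroup.zpowers σ) := by
    rw [IntermediateField.adjoin_le_iff]
    rintro x hx ⟨τ, n, rfl⟩
    have hx' : σ x = x := by
      rcases hx with rfl | rfl
      · exact hA
      · exact hB
    exact MulAction.mem_stabilizer_iff.mp
      (Subgroup.zpow_mem (MulAction.stabilizer (F ≃ₐ[ℚ] F) x) (MulAction.mem_stabilizer_iff.mpr hx') n)
  ext x
  have hx : x ∈ IntermediateField.fixedField (Subgroup.zpowers σ) :=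
    h (D.adjoin_eq_top ▸ IntermediateField.mem_top)
  exact hx ⟨σ, Subgroup.mem_zpowers σ⟩

theorem σ₁_sqrtB : D.σ₁ D.sqrtB = -D.sqrtB := by
  have h : D.σ₁ D.sqrtB ^ 2 = D.sqrtB ^ 2 := by
    rw [← map_pow, D.sq_sqrtB, map_intCast]
  rcases sq_eq_sq_iff_eq_or_eq_neg.mp h with h | h
  · exact absurd (D.eq_one_of_fixes D.σ₁_sqrtA h) D.σ₁_ne_one
  · exact h

theorem σ₂_sqrtA : D.σ₂ D.sqrtA = -D.sqrtA := by
  have h : D.σ₂ D.sqrtA ^ 2 = D.sqrtA ^ 2 := by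
    rw [← map_pow, D.sq_sqrtA, map_intCast]
  rcases sq_eq_sq_iff_eq_or_eq_neg.mp h with h | h
  · exact absurd (D.eq_one_of_fixes h D.σ₂_sqrtB) D.σ₂_ne_one
  · exact h

theorem σ₁_sqrtC : D.σ₁ D.sqrtC = -D.sqrtC := by
  simp only [sqrtC, map_div₀, map_mul, D.σ₁_sqrtA, D.σ₁_sqrtB, map_natCast]
  ring

theorem σ₂_sqrtC : D.σ₂ D.sqrtC = -D.sqrtC := by
  simp only [sqrtC, map_div₀, map_mul, D.σ₂_sqrtA, D.σ₂_sqrtB, map_natCast]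
  ring

theorem σ₁_elt (s : Fin 4 → ℤ) : D.σ₁ (D.elt s) =
    (s 0 : F) + (s 1 : F) * D.sqrtA - (s 2 : F) * D.sqrtB - (s 3 : F) * D.sqrtC := by
  simp only [elt, map_add, map_mul, map_intCast, D.σ₁_sqrtA, D.σ₁_sqrtB, D.σ₁_sqrtC]
  ring

theorem σ₂_elt (s : Fin 4 → ℤ) : D.σ₂ (D.elt s) =
    (s 0 : F) - (s 1 : F) * D.sqrtA + (s 2 : F) * D.sqrtB - (s 3 : F) * D.sqrtC := by
  simp only [elt, map_add, map_mul, map_intCast, D.σ₂_sqrtA, D.σ₂_sqrtB, D.σ₂_sqrtC]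
  ring

theorem mem_F₁ (s : Fin 4 → ℤ) : D.elt s * D.σ₁ (D.elt s) ∈ D.F₁ := by
  have hA : D.sqrtA ∈ D.F₁ := IntermediateField.mem_adjoin_simple_self ℚ _
  have hi : ∀ n : ℤ, (n : F) ∈ D.F₁ := fun n => intCast_mem _ n
  have hn : (Int.gcd D.a D.b : F) ∈ D.F₁ := natCast_mem _ _
  have e : D.elt s * D.σ₁ (D.elt s) = ((s 0 : F) + (s 1 : F) * D.sqrtA) ^ 2 -
      (D.b : F) * ((s 2 : F) + (s 3 : F) * (D.sqrtA / (Int.gcd D.a D.b : F))) ^ 2 := by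
    rw [σ₁_elt, elt, sqrtC, ← D.sq_sqrtB]
    ring
  rw [e]
  exact sub_mem (pow_mem (add_mem (hi _) (mul_mem (hi _) hA)) 2)
    (mul_mem (hi _) (pow_mem (add_mem (hi _) (mul_mem (hi _) (div_mem hA hn))) 2))

theorem mem_F₂ (s : Fin 4 → ℤ) : D.elt s * D.σ₂ (D.elt s) ∈ D.F₂ := by
  have hB : D.sqrtB ∈ D.F₂ := IntermediateField.mem_adjoin_simple_self ℚ _
  have hi : ∀ n : ℤ, (n : F) ∈ D.F₂ := fun n => intCast_mem _ n
  have hn : (Int.gcd D.a D.b : F) ∈ D.F₂ := natCast_mem _ _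
  have e : D.elt s * D.σ₂ (D.elt s) = ((s 0 : F) + (s 2 : F) * D.sqrtB) ^ 2 -
      (D.a : F) * ((s 1 : F) + (s 3 : F) * (D.sqrtB / (Int.gcd D.a D.b : F))) ^ 2 := by
    rw [σ₂_elt, elt, sqrtC, ← D.sq_sqrtA]
    ring
  rw [e]
  exact sub_mem (pow_mem (add_mem (hi _) (mul_mem (hi _) hB)) 2)
    (mul_mem (hi _) (pow_mem (add_mem (hi _) (mul_mem (hi _) (div_mem hB hn))) 2))

theorem mem_F₃ (s : Fin 4 → ℤ) : D.σ₁ (D.elt s) * D.σ₂ (D.elt s) ∈ D.F₃ := by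
  have hC : D.sqrtC ∈ D.F₃ := IntermediateField.mem_adjoin_simple_self ℚ _
  have hi : ∀ n : ℤ, (n : F) ∈ D.F₃ := fun n => intCast_mem _ n
  have hn : (Int.gcd D.a D.b : F) ∈ D.F₃ := natCast_mem _ _
  have e : D.σ₁ (D.elt s) * D.σ₂ (D.elt s) = ((s 0 : F) - (s 3 : F) * D.sqrtC) ^ 2 -
      ((s 1 : F) ^ 2 * (D.a : F) + (s 2 : F) ^ 2 * (D.b : F) -
        ((2 * s 1 * s 2 : ℤ) : F) * ((Int.gcd D.a D.b : F) * D.sqrtC)) := by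
    rw [σ₁_elt, σ₂_elt, D.gcd_mul_sqrtC, ← D.sq_sqrtA, ← D.sq_sqrtB]
    push_cast
    ring
  rw [e]
  exact sub_mem (pow_mem (sub_mem (hi _) (mul_mem (hi _) hC)) 2)
    (sub_mem (add_mem (mul_mem (pow_mem (hi _) 2) (hi _)) (mul_mem (pow_mem (hi _) 2) (hi _)))
      (mul_mem (hi _) (mul_mem hn hC)))

/-- An algebraic integer of `F` that lies in the subfield `K`, as an element of `𝓞 K`. -/
def toInt (K : IntermediateField ℚ F) (x : F) (hK : x ∈ K) (hx : IsIntegral ℤ x) : 𝓞 K :=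
  ⟨⟨x, hK⟩, (isIntegral_algHom_iff (K.val.restrictScalars ℤ) Subtype.val_injective).mp hx⟩

/-- `√a` as an element of `𝓞 F₁`. -/
noncomputable def intA : 𝓞 D.F₁ :=
  toInt D.F₁ D.sqrtA (IntermediateField.mem_adjoin_simple_self ℚ _) (isIntegral_of_sq D.sq_sqrtA)

/-- `√b` as an element of `𝓞 F₂`. -/
noncomputable def intB : 𝓞 D.F₂ :=
  toInt D.F₂ D.sqrtB (IntermediateField.mem_adjoin_simple_self ℚ _) (isIntegral_of_sq D.sq_sqrtB)

/-- `√c` as an element of `𝓞 F₃`. -/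
noncomputable def intC : 𝓞 D.F₃ :=
  toInt D.F₃ D.sqrtC (IntermediateField.mem_adjoin_simple_self ℚ _) (isIntegral_of_sq D.sq_sqrtC)

/-- `S σ₁(S)` as an element of `𝓞 F₁`. -/
noncomputable def T₁ (s : Fin 4 → ℤ) : 𝓞 D.F₁ :=
  toInt D.F₁ (D.elt s * D.σ₁ (D.elt s)) (D.mem_F₁ s)
    ((D.isIntegral_elt s).mul (isIntegral_map D.σ₁ (D.isIntegral_elt s)))

/-- `S σ₂(S)` as an element of `𝓞 F₂`. -/
noncomputable def T₂ (s : Fin 4 → ℤ) : 𝓞 D.F₂ :=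
  toInt D.F₂ (D.elt s * D.σ₂ (D.elt s)) (D.mem_F₂ s)
    ((D.isIntegral_elt s).mul (isIntegral_map D.σ₂ (D.isIntegral_elt s)))

/-- `σ₁(S) σ₂(S)` as an element of `𝓞 F₃`. -/
noncomputable def T₁₂ (s : Fin 4 → ℤ) : 𝓞 D.F₃ :=
  toInt D.F₃ (D.σ₁ (D.elt s) * D.σ₂ (D.elt s)) (D.mem_F₃ s)
    ((isIntegral_map D.σ₁ (D.isIntegral_elt s)).mul (isIntegral_map D.σ₂ (D.isIntegral_elt s)))

/-- The ideal `𝔭₁ = (p, √a)` of `𝓞 F₁`. -/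
noncomputable def 𝔭₁ (p : ℕ) : Ideal (𝓞 D.F₁) := Ideal.span {(p : 𝓞 D.F₁), D.intA}

/-- The ideal `𝔭₂ = (p, √b)` of `𝓞 F₂`. -/
noncomputable def 𝔭₂ (p : ℕ) : Ideal (𝓞 D.F₂) := Ideal.span {(p : 𝓞 D.F₂), D.intB}

/-- The ideal `𝔭₃ᵢ = (p, √c + (-1)ⁱ C)` of `𝓞 F₃`. -/
noncomputable def 𝔭₃ (p : ℕ) (C : ℤ) (i : ℕ) : Ideal (𝓞 D.F₃) :=
  Ideal.span {(p : 𝓞 D.F₃), D.intC + (-1) ^ i * (C : 𝓞 D.F₃)}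

end BiquadraticField

/-- The exponent of `𝔭` in the factorization of the principal ideal `(x)`; for a nonzero prime
ideal `𝔭` of a Dedekind domain and `x ≠ 0` this is the `𝔭`-adic valuation `v_𝔭(x)`. -/
noncomputable def idealVal {R : Type*} [CommRing R] (𝔭 : Ideal R) (x : R) : ℕ :=
  multiplicity 𝔭 (Ideal.span {x})

open Classical in
/-- The Hilbert symbol `(x, y)` of a field `K`: it is `1` if `x ξ² + y η² = 1` is solvable in `K`,
and `-1` otherwise (used for a local field `K` and nonzero `x`, `y`). -/
noncomputable def hilbertSymbol (K : Type*) [Field K] (x y : K) : ℤ :=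
  if ∃ ξ η : K, x * ξ ^ 2 + y * η ^ 2 = 1 then 1 else -1

/-! Put `E = ±C`, `Q = (p, √a, √c + E)` and `Q' = (p, √a, √c - E)` in `𝓞 F`. Since `p` ramifies in
`F₁` and `F₂` and splits in `F₃`, one gets `Q Q' = (p, √a) = (p, √b)`, `Q² = (p, √c + E)` and `(Q
Q')² = (p)`. As `[F : ℚ] ≤ 4`, both `Q` and `Q'` have norm `p`; they are distinct and are the only
primes above `p`.

The residue field at `Q` has `p ≡ 3 (mod 4)` elements, so `-1` is not a square in it. Then a unit is
always of the form `(1 + ξ²)/η²` locally, while `1 + ξ²` always has even valuation; thus `(-1, S)`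
at `Q` is the parity of `m = v_Q(S)` (`hilbertSymbol_neg_one_eq_one_iff`).

Both `σ₁` and `σ₂` negate `√c`, hence exchange `Q` and `Q'`. With `m' = v_{Q'}(S)`, the first two
valuations in the combination equal `m + m'`, and the one in `F₃` at `(p, √c + E)` equals `m'`,
because that prime becomes `Q²`. The combination is `2(m + m') - 2m' = 2m` (`idealVal_combination`),
divisible by `4` exactly when `m` is even. -/

/-! ### Squares near `1`, and residue rings in which `-1` is not a square -/

theorem isSquare_one_add_of_norm_lt_one {L : Type*} [NormedField L] [IsUltrametricDist L]
    [CompleteSpace L] (h2 : ‖(2 : L)‖ = 1) {m : L} (hm : ‖m‖ < 1) : IsSquare (1 + m) := by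
  -- A fixed point `y` of `f` satisfies `(1 + y)² = 1 + m`. As `‖2‖ = 1`, `f` contracts the ball of
  -- radius `‖m‖` by the factor `‖m‖`.
  let f : L → L := fun z => (m - z ^ 2) / 2
  let s : Set L := Metric.closedBall 0 ‖m‖
  have h20 : (2 : L) ≠ 0 := by
    intro h
    simp [h] at h2
  have hs : Set.MapsTo f s s := by
    intro z hz
    simp only [s, mem_closedBall_zero_iff] at hz ⊢
    rw [norm_div, h2, div_one]
    rw [sub_eq_add_neg]
    refine (IsUltrametricDist.norm_add_le_max _ _).trans (max_le le_rfl ?_)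
    rw [norm_neg, norm_pow]
    nlinarith [norm_nonneg z]
  have hc : ContractingWith ‖m‖₊ (hs.restrict f s s) := by
    refine ⟨by exact_mod_cast hm, LipschitzWith.of_dist_le_mul ?_⟩
    rintro ⟨z, hz⟩ ⟨w, hw⟩
    simp only [s, mem_closedBall_zero_iff] at hz hw
    change dist (f z) (f w) ≤ ‖m‖ * dist z w
    have e : f z - f w = -((z + w) * (z - w)) / 2 := by
      simp only [f]
      ring
    rw [dist_eq_norm, dist_eq_norm, e, norm_div, h2, div_one, norm_neg, norm_mul]
    exact mul_le_mul_of_nonneg_right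
      ((IsUltrametricDist.norm_add_le_max _ _).trans (max_le hz hw)) (norm_nonneg _)
  obtain ⟨y, -, hy, -⟩ := hc.exists_fixedPoint' (Metric.isClosed_closedBall.isComplete) hs
    (Metric.mem_closedBall_self (norm_nonneg m)) (edist_ne_top _ _)
  refine ⟨1 + y, ?_⟩
  have hy' : (m - y ^ 2) / 2 = y := hy
  rw [div_eq_iff h20] at hy'
  linear_combination hy'

theorem Ideal.one_add_sq_notMem {R : Type*} [CommRing R] {I : Ideal R}
    (h : ¬ IsSquare (-1 : R ⧸ I)) (r : R) : 1 + r ^ 2 ∉ I := by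
  intro hr
  refine h ⟨Ideal.Quotient.mk _ r, ?_⟩
  have := Ideal.Quotient.eq_zero_iff_mem.mpr hr
  simp only [map_add, map_one, map_pow] at this
  linear_combination -this

theorem Ideal.two_notMem {R : Type*} [CommRing R] {I : Ideal R}
    (h : ¬ IsSquare (-1 : R ⧸ I)) : (2 : R) ∉ I := by
  have := one_add_sq_notMem h 1
  norm_num at this
  exact this

/-! ### The Hilbert symbol `(-1, x)` at a finite place -/

namespace IsDedekindDomain.HeightOneSpectrum

variable {K : Type*} [Field K] [NumberField K] (v : HeightOneSpectrum (𝓞 K))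

theorem valued_algebraMap (x : K) :
    Valued.v (algebraMap K (v.adicCompletion K) x) = v.valuation K x := by
  rw [algebraMap_adicCompletion]
  exact valuedAdicCompletion_eq_valuation' v x

theorem isSquare_one_add_of_valued_lt_one (h2 : (2 : 𝓞 K) ∉ v.asIdeal)
    {m : v.adicCompletion K} (hm : Valued.v m < 1) : IsSquare (1 + m) := by
  apply isSquare_one_add_of_norm_lt_one
  · have h : Valued.v (2 : v.adicCompletion K) = 1 := by
      have := valued_algebraMap v (algebraMap (𝓞 K) K 2)
      rwa [(valuation_eq_one_iff_notMem v).mpr h2, map_ofNat, map_ofNat] at this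
    exact le_antisymm (Valued.toNormedField.norm_le_one_iff.mpr h.le)
      (Valued.toNormedField.one_le_norm_iff.mpr h.ge)
  · exact Valued.toNormedField.norm_lt_one_iff.mpr hm

/-- Density of `K` first gives an approximation in `K`, which is `v`-integral and so is congruent to
an element of `𝓞 K`. -/
theorem exists_valued_sub_algebraMap_lt_one {ξ : v.adicCompletion K} (hξ : Valued.v ξ ≤ 1) :
    ∃ r : 𝓞 K, Valued.v (ξ - algebraMap K (v.adicCompletion K) (algebraMap (𝓞 K) K r)) < 1 := by
  have ho : IsOpen {y : v.adicCompletion K | Valued.v (ξ - y) < 1} := by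
    have : {y : v.adicCompletion K | Valued.v (ξ - y) < 1} = Metric.ball ξ 1 := by
      ext y
      rw [Metric.mem_ball, dist_comm, dist_eq_norm]
      exact (Valued.toNormedField.norm_lt_one_iff (L := v.adicCompletion K) (x := ξ - y)).symm
    rw [this]
    exact Metric.isOpen_ball
  obtain ⟨x, hx⟩ := (denseRange_algebraMap K v).exists_mem_open ho ⟨ξ, by simp⟩
  have hx1 : v.valuation K x ≤ 1 := by
    rw [← valued_algebraMap]
    have e : algebraMap K (v.adicCompletion K) x = ξ - (ξ - algebraMap K _ x) := by ring
    rw [e]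
    exact (Valuation.map_sub _ _ _).trans (max_le hξ (le_of_lt hx))
  obtain ⟨r, hr⟩ := exists_valuation_sub_lt_of_integer v hx1 1
  refine ⟨r, ?_⟩
  have e : ξ - algebraMap K (v.adicCompletion K) (algebraMap (𝓞 K) K r) =
      (ξ - algebraMap K _ x) - algebraMap K _ (algebraMap (𝓞 K) K r - x) := by
    rw [map_sub]
    ring
  rw [e]
  refine (Valuation.map_sub _ _ _).trans_lt (max_lt hx ?_)
  rw [valued_algebraMap]
  simpa using hr

/-- If `ξ` is integral, it is congruent to some `r` in `𝓞 K` and `1 + r²` is a unit at `v`;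
otherwise `ξ²` dominates `1`. Either way the valuation is even. -/
theorem exists_valued_one_add_sq_eq_sq (h : ¬ IsSquare (-1 : 𝓞 K ⧸ v.asIdeal))
    (ξ : v.adicCompletion K) :
    ∃ y : v.adicCompletion K, y ≠ 0 ∧ Valued.v (1 + ξ ^ 2) = Valued.v y ^ 2 := by
  rcases le_or_gt (Valued.v ξ) 1 with h1 | h1
  · refine ⟨1, one_ne_zero, ?_⟩
    obtain ⟨r, hr⟩ := exists_valued_sub_algebraMap_lt_one v h1
    set ρ := algebraMap K (v.adicCompletion K) (algebraMap (𝓞 K) K r) with hρ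
    have hr1 : Valued.v (1 + ρ ^ 2) = 1 := by
      have := valued_algebraMap v (algebraMap (𝓞 K) K (1 + r ^ 2))
      rwa [(valuation_eq_one_iff_notMem v).mpr (Ideal.one_add_sq_notMem h r), map_add, map_add, map_one,
        map_one, map_pow, map_pow] at this
    have hρ1 : Valued.v ρ ≤ 1 := by
      rw [hρ, valued_algebraMap]
      exact valuation_le_one v r
    have hlt : Valued.v ((ξ - ρ) * (ξ + ρ)) < 1 := by
      rw [map_mul]
      exact mul_lt_one_of_lt_of_le hr ((Valuation.map_add _ _ _).trans (max_le h1 hρ1))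
    have e : 1 + ξ ^ 2 = (1 + ρ ^ 2) + (ξ - ρ) * (ξ + ρ) := by ring
    rw [e, Valuation.map_add_eq_of_lt_left _ (by rwa [hr1]), hr1, map_one, one_pow]
  · refine ⟨ξ, by rintro rfl; simp at h1, ?_⟩
    rw [Valuation.map_add_eq_of_lt_right, map_pow]
    rw [map_one, map_pow]
    exact one_lt_pow₀ h1 two_ne_zero

/-- A nonsquare `-1` forces the residue field to have odd order, and there the quadratics `X² + 1`
and `-r Y²` take values with sum zero. If `y` vanished, `-1` would be a square. -/
theorem exists_one_add_sq_sub_mem [Finite (𝓞 K ⧸ v.asIdeal)]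
    (h : ¬ IsSquare (-1 : 𝓞 K ⧸ v.asIdeal)) {r : 𝓞 K} (hr : r ∉ v.asIdeal) :
    ∃ x y : 𝓞 K, 1 + x ^ 2 - r * y ^ 2 ∈ v.asIdeal ∧ y ∉ v.asIdeal := by
  have : v.asIdeal.IsMaximal := v.isMaximal
  let := Ideal.Quotient.field v.asIdeal
  let := Fintype.ofFinite (𝓞 K ⧸ v.asIdeal)
  set q := Ideal.Quotient.mk v.asIdeal with hq
  have hr0 : q r ≠ 0 := fun h0 => hr (Ideal.Quotient.eq_zero_iff_mem.mp h0)
  have hodd : Fintype.card (𝓞 K ⧸ v.asIdeal) % 2 = 1 := by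
    have := mt FiniteField.isSquare_neg_one_iff.mpr h
    push Not at this
    omega
  obtain ⟨a, b, hab⟩ := FiniteField.exists_root_sum_quadratic
    (f := Polynomial.X ^ 2 + Polynomial.C 1) (g := Polynomial.C (-q r) * Polynomial.X ^ 2)
    (Polynomial.degree_X_pow_add_C (by norm_num) _)
    (Polynomial.degree_C_mul_X_pow 2 (neg_ne_zero.mpr hr0)) hodd
  obtain ⟨x, rfl⟩ := Ideal.Quotient.mk_surjective a
  obtain ⟨y, rfl⟩ := Ideal.Quotient.mk_surjective b
  simp only [Polynomial.eval_add, Polynomial.eval_pow, Polynomial.eval_X, Polynomial.eval_C,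
    Polynomial.eval_mul] at hab
  have hmem : 1 + x ^ 2 - r * y ^ 2 ∈ v.asIdeal := by
    rw [← Ideal.Quotient.eq_zero_iff_mem]
    simp only [map_add, map_sub, map_mul, map_pow, map_one]
    linear_combination hab
  refine ⟨x, y, hmem, fun hy => Ideal.one_add_sq_notMem h x ?_⟩
  have := add_mem hmem (Ideal.mul_mem_left _ (r * y) hy)
  convert this using 1
  ring

/-- The equation is solved modulo `v` and lifted, the error being absorbed in a square close to `1`.
-/
theorem exists_mul_sq_eq_one_add_sq [Finite (𝓞 K ⧸ v.asIdeal)]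
    (h : ¬ IsSquare (-1 : 𝓞 K ⧸ v.asIdeal)) {u : K} (hu : v.valuation K u = 1) :
    ∃ ξ η : v.adicCompletion K, algebraMap K _ u * η ^ 2 = 1 + ξ ^ 2 := by
  obtain ⟨r, hr⟩ := exists_valuation_sub_lt_of_integer v hu.le 1
  rw [Units.val_one] at hr
  have hr1 : r ∉ v.asIdeal := by
    rw [← valuation_eq_one_iff_notMem (K := K)]
    have e : algebraMap (𝓞 K) K r = u + (algebraMap (𝓞 K) K r - u) := by ring
    rw [e, Valuation.map_add_eq_of_lt_left _ (by rwa [hu]), hu]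
  obtain ⟨x, y, hxy, hy⟩ := exists_one_add_sq_sub_mem v h hr1
  have hy1 : v.valuation K (algebraMap (𝓞 K) K y) = 1 := (valuation_eq_one_iff_notMem v).mpr hy
  set X := algebraMap (𝓞 K) K x
  set Y := algebraMap (𝓞 K) K y
  set R := algebraMap (𝓞 K) K r
  have hu0 : u ≠ 0 := by rintro rfl; simp at hu
  have hY0 : Y ≠ 0 := by intro h0; simp [h0] at hy1
  have hd : v.valuation K (1 + X ^ 2 - u * Y ^ 2) < 1 := by
    have e : 1 + X ^ 2 - u * Y ^ 2 = algebraMap (𝓞 K) K (1 + x ^ 2 - r * y ^ 2)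
        + (R - u) * Y ^ 2 := by
      simp only [map_add, map_sub, map_mul, map_pow, map_one, X, Y, R]
      ring
    rw [e]
    refine (Valuation.map_add _ _ _).trans_lt (max_lt ((valuation_lt_one_iff_mem v _).mpr hxy) ?_)
    rwa [map_mul, map_pow, hy1, one_pow, mul_one]
  -- Chosen so that `u Y² (1 + m) = 1 + X²` exactly; `1 + m` is then a square in the completion.
  set m : K := (1 + X ^ 2 - u * Y ^ 2) / (u * Y ^ 2) with hm
  have hm1 : v.valuation K m < 1 := by
    rw [hm, map_div₀, map_mul, map_pow, hu, hy1, one_pow, mul_one, div_one]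
    exact hd
  obtain ⟨t, ht⟩ := isSquare_one_add_of_valued_lt_one v (Ideal.two_notMem h)
    (m := algebraMap K _ m) (by rwa [valued_algebraMap])
  refine ⟨algebraMap K _ X, algebraMap K _ Y * t, ?_⟩
  have e : u * (Y ^ 2 * (1 + m)) = 1 + X ^ 2 := by
    rw [hm]
    field_simp
    ring
  have e' := congrArg (algebraMap K (v.adicCompletion K)) e
  simp only [map_mul, map_add, map_pow, map_one] at e'
  rw [mul_pow, sq t, ← ht, e']

/-- If `-1` is not a square in the residue field, the Hilbert symbol `(-1, x)` is the parity of the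
valuation of `x`. -/
theorem hilbertSymbol_neg_one_eq_one_iff [Finite (𝓞 K ⧸ v.asIdeal)]
    (h : ¬ IsSquare (-1 : 𝓞 K ⧸ v.asIdeal)) {x : K} (hx : x ≠ 0) :
    hilbertSymbol (v.adicCompletion K) (-1) (algebraMap K (v.adicCompletion K) x) = 1 ↔
      Even (WithZero.log (v.valuation K x)) := by
  have hvx : v.valuation K x ≠ 0 := (Valuation.ne_zero_iff _).mpr hx
  have hsymb : hilbertSymbol (v.adicCompletion K) (-1) (algebraMap K (v.adicCompletion K) x) = 1 ↔
      ∃ ξ η : v.adicCompletion K, -1 * ξ ^ 2 + algebraMap K _ x * η ^ 2 = 1 := by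
    unfold hilbertSymbol
    split_ifs with hs
    · exact iff_of_true rfl hs
    · exact iff_of_false (by norm_num) hs
  rw [hsymb]
  constructor
  · rintro ⟨ξ, η, hξη⟩
    obtain ⟨y, hy0, hy⟩ := exists_valued_one_add_sq_eq_sq v h ξ
    have e : algebraMap K _ x * η ^ 2 = 1 + ξ ^ 2 := by linear_combination hξη
    have hyv : Valued.v y ≠ 0 := (Valuation.ne_zero_iff _).mpr hy0
    rw [← e, map_mul, map_pow, valued_algebraMap] at hy
    have hη : Valued.v η ≠ 0 := by
      intro h0
      rw [h0, zero_pow two_ne_zero, mul_zero] at hy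
      exact pow_ne_zero 2 hyv hy.symm
    have := congrArg WithZero.log hy
    rw [WithZero.log_mul hvx (pow_ne_zero 2 hη), WithZero.log_pow, WithZero.log_pow] at this
    refine ⟨WithZero.log (Valued.v y) - WithZero.log (Valued.v η), ?_⟩
    simp only [nsmul_eq_mul, Nat.cast_ofNat] at this
    linear_combination this
  · rintro ⟨k, hk⟩
    -- `π` has half the valuation of `x`, so `x / π²` is a unit at `v`, and `π` is absorbed into
    -- `η`.
    obtain ⟨π, hπ⟩ := v.valuation_surjective K (WithZero.exp k)
    have hπ0 : π ≠ 0 := by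
      rintro rfl
      rw [map_zero] at hπ
      exact WithZero.exp_ne_zero hπ.symm
    have hu : v.valuation K (x / π ^ 2) = 1 := by
      rw [map_div₀, map_pow, hπ, ← WithZero.exp_log hvx, hk, WithZero.exp_add, sq]
      exact div_self (mul_ne_zero WithZero.exp_ne_zero WithZero.exp_ne_zero)
    obtain ⟨ξ, η, hξη⟩ := exists_mul_sq_eq_one_add_sq v h hu
    refine ⟨ξ, η / algebraMap K _ π, ?_⟩
    rw [map_div₀, map_pow] at hξη
    linear_combination hξη

end IsDedekindDomain.HeightOneSpectrum

/-! ### Multiplicities under extension, and ideals with two generators -/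

namespace Ideal

/-- Here `e` is the ramification index. Writing `(x) = 𝔭ⁿ J` with `𝔭 ∤ J`, the extension is `Q^(en)
Iⁿ` times that of `J`. Since `𝔭` is maximal, `Q` contracts to `𝔭` and so cannot divide the extension
of `J`. -/
theorem multiplicity_span_map {R S : Type*} [CommRing R] [IsDedekindDomain R] [CommRing S]
    [IsDedekindDomain S] {f : R →+* S} (hf : Function.Injective f) {𝔭 : Ideal R} (h𝔭 : Prime 𝔭)
    {Q I : Ideal S} (hQ : Prime Q) {e : ℕ} (he : e ≠ 0) (hmap : 𝔭.map f = Q ^ e * I)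
    (hI : ¬ Q ∣ I) {x : R} (hx : x ≠ 0) :
    multiplicity Q (span {f x}) = e * multiplicity 𝔭 (span {x}) := by
  have hx' : span {x} ≠ (0 : Ideal R) := by simpa using hx
  have hfx : span {f x} ≠ (0 : Ideal S) := by simpa using (map_ne_zero_iff f hf).mpr hx
  obtain ⟨J, hJ, hJd⟩ := (FiniteMultiplicity.of_prime_left h𝔭 hx').exists_eq_pow_mul_and_not_dvd
  set n := multiplicity 𝔭 (span {x})
  have hmax : 𝔭.IsMaximal := (isPrime_of_prime h𝔭).isMaximal h𝔭.ne_zero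
  have hcomap : 𝔭 = Q.comap f := by
    refine hmax.eq_of_le (comap_ne_top f (isPrime_of_prime hQ).ne_top) ?_
    rw [← map_le_iff_le_comap, hmap]
    exact mul_le_left.trans (pow_le_self he)
  have hQJ : ¬ Q ∣ J.map f := by
    intro h
    refine hJd (dvd_iff_le.mpr ?_)
    rw [hcomap, ← map_le_iff_le_comap]
    exact dvd_iff_le.mp h
  have hmain : span {f x} = Q ^ (e * n) * (I ^ n * J.map f) := by
    have := congrArg (map f) hJ
    rw [map_span, Set.image_singleton] at this
    rw [this, Ideal.map_mul, Ideal.map_pow, hmap, mul_pow, pow_mul, mul_assoc]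
  have hnd : ¬ Q ∣ I ^ n * J.map f := by
    intro h
    rcases hQ.dvd_or_dvd h with h | h
    · exact hI (hQ.dvd_of_dvd_pow h)
    · exact hQJ h
  have hfin := FiniteMultiplicity.of_prime_left hQ hfx
  rw [hmain] at hfin ⊢
  rw [multiplicity_mul hQ hfin, multiplicity_pow_self_of_prime hQ,
    multiplicity_eq_zero.mpr hnd, add_zero]

theorem sq_injective {R : Type*} [CommRing R] [IsDedekindDomain R] {I J : Ideal R}
    (h : I ^ 2 = J ^ 2) : I = J :=
  dvd_antisymm ((UniqueFactorizationMonoid.pow_dvd_pow_iff_dvd two_ne_zero).mp h.dvd)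
    ((UniqueFactorizationMonoid.pow_dvd_pow_iff_dvd two_ne_zero).mp h.symm.dvd)

/-- Ideal addition is idempotent, so the product expands to `J² + J(I + I') + I I' = J + J² = J`. -/
theorem sup_mul_sup_eq {R : Type*} [CommRing R] {J I I' : Ideal R} (hJ : J ^ 2 = I * I')
    (h : I ⊔ I' = ⊤) : (J ⊔ I) * (J ⊔ I') = J := by
  have e : (J + I) * (J + I') = J * ((1 + (I + I')) + J) := by
    have : (J + I) * (J + I') = J ^ 2 + J * (I + I') + I * I' := by ring
    rw [this, ← hJ, Submodule.add_eq_sup I I', h, ← one_eq_top]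
    rw [mul_add, mul_add, mul_one, ← sq, add_right_comm, Submodule.add_eq_sup (J ^ 2), sup_idem,
      Submodule.add_eq_sup J J, sup_idem, add_comm]
  rw [← Submodule.add_eq_sup, ← Submodule.add_eq_sup, e, Submodule.add_eq_sup I I', h]
  simp

/-- The square expands to `I I' + I J + I² = I (I + I' + J) = I`. -/
theorem sup_sq_eq {R : Type*} [CommRing R] {J I I' : Ideal R} (hJ : J ^ 2 = I * I')
    (h : I ⊔ I' = ⊤) : (J ⊔ I) ^ 2 = I := by
  have e : (J + I) ^ 2 = I * ((I + I') + J) := by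
    have : (J + I) ^ 2 = J ^ 2 + (I * J + I * J) + I * I := by ring
    rw [this, hJ, Submodule.add_eq_sup (I * J), sup_idem]
    ring
  rw [← Submodule.add_eq_sup, e, Submodule.add_eq_sup I I', h]
  simp

theorem span_pair_sq_eq {R : Type*} [CommRing R] {p n : ℤ} (hp : Prime p) (hn : Squarefree n)
    (hpn : p ∣ n) {x : R} (hx : x ^ 2 = (n : R)) :
    span {(p : R), x} ^ 2 = span {(p : R)} := by
  obtain ⟨k, rfl⟩ := hpn
  have hco : IsCoprime p k := by
    refine hp.irreducible.coprime_iff_not_dvd.mpr ?_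
    rintro ⟨l, rfl⟩
    exact hp.not_isUnit (hn p ⟨l, by ring⟩)
  obtain ⟨u, w, huw⟩ := hco
  have huw' : (u : R) * p + w * k = 1 := by exact_mod_cast congrArg (Int.cast : ℤ → R) huw
  push_cast at hx
  rw [sq, span_pair_mul_span_pair]
  apply le_antisymm
  · rw [span_le]
    rintro y (rfl | rfl | rfl | rfl)
    · exact mul_mem_left _ _ (mem_span_singleton_self _)
    · exact mul_mem_right _ _ (mem_span_singleton_self _)
    · exact mul_mem_left _ _ (mem_span_singleton_self _)
    · rw [← sq, hx]
      exact mul_mem_right _ _ (mem_span_singleton_self _)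
  · rw [span_singleton_le_iff_mem]
    -- With `n = pk` and `up + wk = 1`, multiplying the Bézout relation by `p` gives `p = u p² + w
    -- x²`.
    have e : (p : R) = u * (p * p) + w * (x * x) := by
      linear_combination (-(p : R)) * huw' - (w : R) * hx
    have h1 : (p : R) * p ∈ span {(p : R) * p, (p : R) * x, x * p, x * x} := subset_span (by simp)
    have h2 : x * x ∈ span {(p : R) * p, (p : R) * x, x * p, x * x} := subset_span (by simp)
    have h3 := add_mem (mul_mem_left _ (u : R) h1) (mul_mem_left _ (w : R) h2)
    rwa [← e] at h3

theorem span_pair_add_sup_span_pair_sub {R : Type*} [CommRing R] {p E : ℤ}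
    (hE : IsCoprime p (2 * E)) (x : R) :
    span {(p : R), x + E} ⊔ span {(p : R), x - E} = ⊤ := by
  obtain ⟨u, w, huw⟩ := hE
  have huw' : (u : R) * p + w * (2 * E) = 1 := by exact_mod_cast congrArg (Int.cast : ℤ → R) huw
  rw [eq_top_iff_one]
  have e : (1 : R) = (u * p + w * (x + E)) + (-w) * (x - E) := by linear_combination -huw'
  rw [e]
  exact add_mem (mem_sup_left (add_mem (mul_mem_left _ _ (subset_span (by simp)))
    (mul_mem_left _ _ (subset_span (by simp)))))
    (mem_sup_right (mul_mem_left _ _ (subset_span (by simp))))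

/-- The product lies in `(p)` because `(x + E)(x - E) = n - E²`; the reverse inclusion uses that the
two ideals are comaximal, their second generators differing by `2E`. -/
theorem span_pair_add_mul_span_pair_sub {R : Type*} [CommRing R] {p E n : ℤ}
    (hE : IsCoprime p (2 * E)) (hn : E ^ 2 ≡ n [ZMOD p]) {x : R} (hx : x ^ 2 = (n : R)) :
    span {(p : R), x + E} * span {(p : R), x - E} = span {(p : R)} := by
  apply le_antisymm
  · obtain ⟨k, hk⟩ := hn.dvd
    have hk' : (n : R) - E ^ 2 = p * k := by exact_mod_cast congrArg (Int.cast : ℤ → R) hk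
    rw [span_pair_mul_span_pair, span_le]
    rintro y (rfl | rfl | rfl | rfl)
    · exact mul_mem_left _ _ (mem_span_singleton_self _)
    · exact mul_mem_right _ _ (mem_span_singleton_self _)
    · exact mul_mem_left _ _ (mem_span_singleton_self _)
    · have e : (x + E) * (x - E) = (p : R) * k := by linear_combination hx + hk'
      rw [e]
      exact mul_mem_right _ _ (mem_span_singleton_self _)
  · have h1 := span_pair_add_sup_span_pair_sub hE x
    rw [← mul_one (span {(p : R)}), one_eq_top, ← h1, mul_sup]
    refine sup_le ?_ ?_
    · rw [mul_comm]
      exact mul_mono le_rfl (span_mono (by simp))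
    · exact mul_mono (span_mono (by simp)) le_rfl

end Ideal

/-! ### Ideals of prime norm -/

theorem Nat.Prime.eq_of_mul_pow_eq_pow {p : ℕ} (hp : p.Prime) {m n k d : ℕ} (hk : k ≠ 0)
    (h : (m * n) ^ k = p ^ d) (hd : d ≤ 2 * k) (hm : m ≠ 1) (hn : n ≠ 1) : m = p ∧ n = p := by
  obtain ⟨i, -, rfl⟩ := (Nat.dvd_prime_pow hp).mp
    (((Dvd.intro n rfl).trans (dvd_pow_self _ hk)).trans h.dvd)
  obtain ⟨j, -, rfl⟩ := (Nat.dvd_prime_pow hp).mp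
    (((Dvd.intro_left _ rfl).trans (dvd_pow_self _ hk)).trans h.dvd)
  rw [← pow_add, ← pow_mul] at h
  have he := Nat.pow_right_injective hp.two_le h
  have hi : i ≠ 0 := by rintro rfl; simp at hm
  have hj : j ≠ 0 := by rintro rfl; simp at hn
  have hij : i + j ≤ 2 := by
    refine Nat.le_of_mul_le_mul_right ?_ (Nat.pos_of_ne_zero hk)
    omega
  have hi1 : i = 1 := by omega
  have hj1 : j = 1 := by omega
  simp [hi1, hj1]

namespace NumberField

variable {K : Type*} [Field K] [NumberField K]

theorem prime_of_absNorm_eq_prime {p : ℕ} (hp : p.Prime) {I : Ideal (𝓞 K)}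
    (h : Ideal.absNorm I = p) : Prime I := by
  refine Ideal.prime_of_isPrime ?_ (Ideal.isPrime_of_irreducible_absNorm (h ▸ hp))
  rintro rfl
  rw [Ideal.absNorm_bot] at h
  exact hp.ne_zero h.symm

/-- Taking norms leaves room for only one factor `p` in each of `I` and `J`. An upper bound on the
degree suffices; `k = 2` serves `F` and `k = 1` the quadratic subfields. -/
theorem absNorm_eq_of_mul_pow_eq_span {p : ℕ} (hp : p.Prime) {I J : Ideal (𝓞 K)} {k : ℕ}
    (hk : k ≠ 0) (h : (I * J) ^ k = Ideal.span {(p : 𝓞 K)}) (hd : Module.finrank ℚ K ≤ 2 * k)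
    (hI : I ≠ ⊤) (hJ : J ≠ ⊤) : Ideal.absNorm I = p ∧ Ideal.absNorm J = p := by
  refine hp.eq_of_mul_pow_eq_pow hk (d := Module.finrank ℚ K) ?_ hd
    (mt Ideal.absNorm_eq_one_iff.mp hI) (mt Ideal.absNorm_eq_one_iff.mp hJ)
  rw [← map_mul, ← map_pow, h, Ideal.absNorm_span_natCast, RingOfIntegers.rank]

theorem span_natCast_ne_top {p : ℕ} (hp : p.Prime) : Ideal.span {(p : 𝓞 K)} ≠ ⊤ := by
  intro h
  have h1 := Ideal.absNorm_span_natCast (S := 𝓞 K) p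
  rw [h, Ideal.absNorm_top, RingOfIntegers.rank] at h1
  exact (Nat.one_lt_pow Module.finrank_pos.ne' hp.one_lt).ne h1

end NumberField

/-! ### Integers of the biquadratic field and its subfields -/

namespace BiquadraticField

variable {F : Type*} [Field F] [NumberField F] (D : BiquadraticField F)

/-- `√a` as an element of `𝓞 F`. -/
noncomputable def ringA : 𝓞 F := ⟨D.sqrtA, isIntegral_of_sq D.sq_sqrtA⟩

/-- `√b` as an element of `𝓞 F`. -/
noncomputable def ringB : 𝓞 F := ⟨D.sqrtB, isIntegral_of_sq D.sq_sqrtB⟩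

/-- `√c` as an element of `𝓞 F`. -/
noncomputable def ringC : 𝓞 F := ⟨D.sqrtC, isIntegral_of_sq D.sq_sqrtC⟩

/-- `S` as an element of `𝓞 F`. -/
noncomputable def ringElt (s : Fin 4 → ℤ) : 𝓞 F := ⟨D.elt s, D.isIntegral_elt s⟩

theorem sq_ringA : D.ringA ^ 2 = (D.a : 𝓞 F) :=
  RingOfIntegers.ext ((map_pow (algebraMap (𝓞 F) F) _ _).trans
    (D.sq_sqrtA.trans (map_intCast (algebraMap (𝓞 F) F) _).symm))

theorem sq_ringB : D.ringB ^ 2 = (D.b : 𝓞 F) :=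
  RingOfIntegers.ext ((map_pow (algebraMap (𝓞 F) F) _ _).trans
    (D.sq_sqrtB.trans (map_intCast (algebraMap (𝓞 F) F) _).symm))

theorem sq_ringC : D.ringC ^ 2 = (D.c : 𝓞 F) :=
  RingOfIntegers.ext ((map_pow (algebraMap (𝓞 F) F) _ _).trans
    (D.sq_sqrtC.trans (map_intCast (algebraMap (𝓞 F) F) _).symm))

theorem finrank_adjoin_sqrt_le {x : F} {n : ℤ} (h : x ^ 2 = (n : F)) :
    Module.finrank ℚ (IntermediateField.adjoin ℚ {x}) ≤ 2 := by
  have hx : IsIntegral ℚ x := Algebra.IsIntegral.isIntegral x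
  rw [IntermediateField.adjoin.finrank hx]
  have hdeg : (Polynomial.X ^ 2 - Polynomial.C (n : ℚ)).natDegree = 2 :=
    Polynomial.natDegree_X_pow_sub_C
  rw [← hdeg]
  refine Polynomial.natDegree_le_of_dvd (minpoly.dvd ℚ x (by simp [h]))
    (Polynomial.X_pow_sub_C_ne_zero (by norm_num) _)

theorem finrank_F₁_le : Module.finrank ℚ D.F₁ ≤ 2 := finrank_adjoin_sqrt_le D.sq_sqrtA

theorem finrank_F₂_le : Module.finrank ℚ D.F₂ ≤ 2 := finrank_adjoin_sqrt_le D.sq_sqrtB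

theorem finrank_F₃_le : Module.finrank ℚ D.F₃ ≤ 2 := finrank_adjoin_sqrt_le D.sq_sqrtC

theorem finrank_le_four (D : BiquadraticField F) : Module.finrank ℚ F ≤ 4 := by
  have h : D.F₁ ⊔ D.F₂ = ⊤ := by
    rw [← D.adjoin_eq_top, F₁, F₂, ← IntermediateField.adjoin_union]
    rfl
  have h1 := IntermediateField.finrank_sup_le D.F₁ D.F₂
  rw [h, IntermediateField.finrank_top'] at h1
  exact h1.trans (Nat.mul_le_mul D.finrank_F₁_le D.finrank_F₂_le)

/-- The inclusion of rings of integers for a subfield of `F`. -/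
noncomputable def incl (K : IntermediateField ℚ F) : 𝓞 K →+* 𝓞 F :=
  RingOfIntegers.mapRingHom K.val

theorem incl_injective (K : IntermediateField ℚ F) : Function.Injective (incl K) := by
  intro x y h
  exact RingOfIntegers.ext (K.val.injective (congrArg (algebraMap (𝓞 F) F) h))

/-- The automorphism of `𝓞 F` induced by an automorphism of `F`. -/
noncomputable def ringAut (σ : F ≃ₐ[ℚ] F) : 𝓞 F →+* 𝓞 F := RingOfIntegers.mapRingHom σ

theorem ringAut_injective (σ : F ≃ₐ[ℚ] F) : Function.Injective (ringAut σ) := by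
  intro x y h
  exact RingOfIntegers.ext (σ.injective (congrArg (algebraMap (𝓞 F) F) h))

theorem incl_intA : incl D.F₁ D.intA = D.ringA := rfl

theorem incl_intB : incl D.F₂ D.intB = D.ringB := rfl

theorem incl_intC : incl D.F₃ D.intC = D.ringC := rfl

theorem sq_intA : D.intA ^ 2 = (D.a : 𝓞 D.F₁) := by
  apply incl_injective
  rw [map_pow, map_intCast, incl_intA, sq_ringA]

theorem sq_intB : D.intB ^ 2 = (D.b : 𝓞 D.F₂) := by
  apply incl_injective
  rw [map_pow, map_intCast, incl_intB, sq_ringB]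

theorem sq_intC : D.intC ^ 2 = (D.c : 𝓞 D.F₃) := by
  apply incl_injective
  rw [map_pow, map_intCast, incl_intC, sq_ringC]

theorem incl_T₁ (s : Fin 4 → ℤ) :
    incl D.F₁ (D.T₁ s) = D.ringElt s * ringAut D.σ₁ (D.ringElt s) := rfl

theorem incl_T₂ (s : Fin 4 → ℤ) :
    incl D.F₂ (D.T₂ s) = D.ringElt s * ringAut D.σ₂ (D.ringElt s) := rfl

theorem incl_T₁₂ (s : Fin 4 → ℤ) :
    incl D.F₃ (D.T₁₂ s) = ringAut D.σ₁ (D.ringElt s) * ringAut D.σ₂ (D.ringElt s) := rfl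

theorem ringAut_σ₁_ringA : ringAut D.σ₁ D.ringA = D.ringA :=
  RingOfIntegers.ext D.σ₁_sqrtA

theorem ringAut_σ₂_ringA : ringAut D.σ₂ D.ringA = -D.ringA :=
  RingOfIntegers.ext D.σ₂_sqrtA

theorem ringAut_σ₁_ringC : ringAut D.σ₁ D.ringC = -D.ringC :=
  RingOfIntegers.ext D.σ₁_sqrtC

theorem ringAut_σ₂_ringC : ringAut D.σ₂ D.ringC = -D.ringC :=
  RingOfIntegers.ext D.σ₂_sqrtC

/-- The ideal `(p, √a)` of `𝓞 F`. -/
noncomputable def J (p : ℕ) : Ideal (𝓞 F) := Ideal.span {(p : 𝓞 F), D.ringA}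

/-- The ideal `(p, √c + E)` of `𝓞 F`. -/
noncomputable def I (p : ℕ) (E : ℤ) : Ideal (𝓞 F) := Ideal.span {(p : 𝓞 F), D.ringC + E}

/-- The ideal `(p, √a, √c + E)` of `𝓞 F`. -/
noncomputable def Q (p : ℕ) (E : ℤ) : Ideal (𝓞 F) := D.J p ⊔ D.I p E

/-! ### Factorization of `p` in `F` -/

section

variable {D} {p : ℕ} {E : ℤ}

theorem I_neg : D.I p (-E) = Ideal.span {(p : 𝓞 F), D.ringC - E} := by
  rw [I, Int.cast_neg, sub_eq_add_neg]

theorem J_sq (hp : p.Prime) (hpa : (p : ℤ) ∣ D.a) : D.J p ^ 2 = Ideal.span {(p : 𝓞 F)} := by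
  have := Ideal.span_pair_sq_eq (Nat.prime_iff_prime_int.mp hp) D.squarefree_a hpa D.sq_ringA
  rwa [Int.cast_natCast] at this

theorem map_𝔭₁ : (D.𝔭₁ p).map (incl D.F₁) = D.J p := by
  rw [𝔭₁, Ideal.map_span, Set.image_pair, map_natCast, incl_intA, J]

/-- `(p, √a)` and `(p, √b)` have the same square `(p)` in `𝓞 F`, hence coincide by unique
factorization. -/
theorem map_𝔭₂ (hp : p.Prime) (hpa : (p : ℤ) ∣ D.a) (hpb : (p : ℤ) ∣ D.b) :
    (D.𝔭₂ p).map (incl D.F₂) = D.J p := by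
  rw [𝔭₂, Ideal.map_span, Set.image_pair, map_natCast, incl_intB]
  apply Ideal.sq_injective
  have := Ideal.span_pair_sq_eq (Nat.prime_iff_prime_int.mp hp) D.squarefree_b hpb D.sq_ringB
  rw [J_sq hp hpa]
  rwa [Int.cast_natCast] at this

theorem span_pair_neg {R : Type*} [CommRing R] (x y : R) :
    Ideal.span {x, -y} = Ideal.span {x, y} := by
  rw [Ideal.span_insert, Ideal.span_insert, Ideal.span_singleton_neg]

theorem map_I {σ : F ≃ₐ[ℚ] F} (hC : ringAut σ D.ringC = -D.ringC) :
    (D.I p E).map (ringAut σ) = D.I p (-E) := by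
  rw [I, Ideal.map_span, Set.image_pair, map_natCast, map_add, hC, map_intCast, I,
    ← span_pair_neg, neg_add, neg_neg, Int.cast_neg]

theorem map_σ₁_Q : (D.Q p E).map (ringAut D.σ₁) = D.Q p (-E) := by
  rw [Q, Ideal.map_sup, map_I D.ringAut_σ₁_ringC, J, Ideal.map_span, Set.image_pair, map_natCast,
    ringAut_σ₁_ringA, Q, J]

/-- Negating `√a` does not change `(p, √a)`, so only the sign of `√c` matters. -/
theorem map_σ₂_Q : (D.Q p E).map (ringAut D.σ₂) = D.Q p (-E) := by
  rw [Q, Ideal.map_sup, map_I D.ringAut_σ₂_ringC, J, Ideal.map_span, Set.image_pair, map_natCast,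
    ringAut_σ₂_ringA, span_pair_neg, Q, J]

variable (D p E) in
/-- `p` is a prime that ramifies in `ℚ(√a)` and splits in `ℚ(√c)`, where `E` is a square root of `c`
modulo `p`. -/
structure IsRamifiedSplit : Prop where
  prime : p.Prime
  dvd_a : (p : ℤ) ∣ D.a
  sq_modEq : E ^ 2 ≡ D.c [ZMOD p]
  coprime : IsCoprime (p : ℤ) (2 * E)

namespace IsRamifiedSplit

theorem neg (h : D.IsRamifiedSplit p E) : D.IsRamifiedSplit p (-E) where
  prime := h.prime
  dvd_a := h.dvd_a
  sq_modEq := by rw [neg_sq]; exact h.sq_modEq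
  coprime := by rw [mul_neg]; exact h.coprime.neg_right

theorem I_mul_I_neg (h : D.IsRamifiedSplit p E) :
    D.I p E * D.I p (-E) = Ideal.span {(p : 𝓞 F)} := by
  have := Ideal.span_pair_add_mul_span_pair_sub h.coprime h.sq_modEq D.sq_ringC
  rw [Int.cast_natCast] at this
  rw [I_neg, I, this]

theorem I_sup_I_neg (h : D.IsRamifiedSplit p E) : D.I p E ⊔ D.I p (-E) = ⊤ := by
  have := Ideal.span_pair_add_sup_span_pair_sub h.coprime D.ringC
  rw [Int.cast_natCast] at this
  rw [I_neg, I, this]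

theorem Q_mul_Q_neg (h : D.IsRamifiedSplit p E) : D.Q p E * D.Q p (-E) = D.J p :=
  Ideal.sup_mul_sup_eq ((J_sq h.prime h.dvd_a).trans h.I_mul_I_neg.symm) h.I_sup_I_neg

theorem Q_sq (h : D.IsRamifiedSplit p E) : D.Q p E ^ 2 = D.I p E :=
  Ideal.sup_sq_eq ((J_sq h.prime h.dvd_a).trans h.I_mul_I_neg.symm) h.I_sup_I_neg

theorem Q_mul_Q_neg_sq (h : D.IsRamifiedSplit p E) :
    (D.Q p E * D.Q p (-E)) ^ 2 = Ideal.span {(p : 𝓞 F)} := by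
  rw [h.Q_mul_Q_neg, J_sq h.prime h.dvd_a]

/-- `σ₁` exchanges `Q p E` and `Q p (-E)`, so if one were the unit ideal, both would be, and so
would `(p)`. -/
theorem Q_ne_top (h : D.IsRamifiedSplit p E) : D.Q p E ≠ ⊤ := by
  intro ht
  have ht' : D.Q p (-E) = ⊤ := by rw [← map_σ₁_Q, ht, Ideal.map_top]
  apply span_natCast_ne_top (K := F) h.prime
  rw [← h.Q_mul_Q_neg_sq, ht, ht']
  simp

theorem absNorm_Q (h : D.IsRamifiedSplit p E) : Ideal.absNorm (D.Q p E) = p :=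
  (absNorm_eq_of_mul_pow_eq_span h.prime two_ne_zero h.Q_mul_Q_neg_sq D.finrank_le_four
    h.Q_ne_top h.neg.Q_ne_top).1

theorem prime_Q (h : D.IsRamifiedSplit p E) : Prime (D.Q p E) :=
  prime_of_absNorm_eq_prime h.prime h.absNorm_Q

theorem isMaximal_Q (h : D.IsRamifiedSplit p E) : (D.Q p E).IsMaximal :=
  (Ideal.isPrime_of_prime h.prime_Q).isMaximal h.prime_Q.ne_zero

theorem Q_ne_Q_neg (h : D.IsRamifiedSplit p E) : D.Q p E ≠ D.Q p (-E) := by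
  intro he
  apply h.Q_ne_top
  rw [eq_top_iff, ← h.I_sup_I_neg]
  exact sup_le le_sup_right (he ▸ le_sup_right)

theorem not_Q_dvd_Q_neg (h : D.IsRamifiedSplit p E) : ¬ D.Q p E ∣ D.Q p (-E) := fun hd =>
  h.Q_ne_Q_neg (h.neg.isMaximal_Q.eq_of_le h.Q_ne_top (Ideal.dvd_iff_le.mp hd)).symm

theorem eq_Q_or_eq_Q_neg (h : D.IsRamifiedSplit p E) {P : Ideal (𝓞 F)} (hP : P.IsPrime)
    (hpP : (p : 𝓞 F) ∈ P) : P = D.Q p E ∨ P = D.Q p (-E) := by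
  have hle : (D.Q p E * D.Q p (-E)) ^ 2 ≤ P := by
    rwa [h.Q_mul_Q_neg_sq, Ideal.span_singleton_le_iff_mem]
  rcases hP.mul_le.mp (hP.le_of_pow_le hle) with hQ | hQ
  · exact Or.inl (h.isMaximal_Q.eq_of_le hP.ne_top hQ).symm
  · exact Or.inr (h.neg.isMaximal_Q.eq_of_le hP.ne_top hQ).symm

theorem natCast_mem_Q : (p : 𝓞 F) ∈ D.Q p E :=
  Ideal.mem_sup_left (Ideal.subset_span (by simp))

/-- The ideal `(p, √a, √c + E)` as a place of `F`. -/
noncomputable def place (h : D.IsRamifiedSplit p E) : HeightOneSpectrum (𝓞 F) :=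
  ⟨D.Q p E, Ideal.isPrime_of_prime h.prime_Q, h.prime_Q.ne_zero⟩

theorem setOf_places_eq (h : D.IsRamifiedSplit p E) :
    {P : HeightOneSpectrum (𝓞 F) | (p : 𝓞 F) ∈ P.asIdeal} = {h.place, h.neg.place} := by
  ext P
  constructor
  · intro hP
    exact (h.eq_Q_or_eq_Q_neg P.isPrime hP).imp HeightOneSpectrum.ext HeightOneSpectrum.ext
  · rintro (rfl | rfl) <;> exact natCast_mem_Q

theorem ncard_places (h : D.IsRamifiedSplit p E) :
    {P : HeightOneSpectrum (𝓞 F) | (p : 𝓞 F) ∈ P.asIdeal}.ncard = 2 := by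
  rw [h.setOf_places_eq]
  exact Set.ncard_pair fun he => h.Q_ne_Q_neg (congrArg HeightOneSpectrum.asIdeal he)

/-- The residue field has exactly `p` elements, since `Q` has norm `p`. -/
theorem not_isSquare_neg_one (h : D.IsRamifiedSplit p E) (hp4 : p % 4 = 3) :
    ¬ IsSquare (-1 : 𝓞 F ⧸ D.Q p E) := by
  have := h.isMaximal_Q
  let := Ideal.Quotient.field (D.Q p E)
  have := (D.Q p E).finiteQuotientOfFreeOfNeBot h.prime_Q.ne_zero
  let := Fintype.ofFinite (𝓞 F ⧸ D.Q p E)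
  intro hs
  apply FiniteField.isSquare_neg_one_iff.mp hs
  have hc := h.absNorm_Q
  rw [Ideal.absNorm_apply, Submodule.cardQuot_apply, Nat.card_eq_fintype_card] at hc
  rw [hc]
  exact hp4

theorem hilbertSymbol_eq_one_iff (h : D.IsRamifiedSplit p E) (hp4 : p % 4 = 3) {s : Fin 4 → ℤ}
    (hS : D.elt s ≠ 0) :
    hilbertSymbol (h.place.adicCompletion F) (-1)
        (algebraMap F (h.place.adicCompletion F) (D.elt s)) = 1 ↔
      Even (multiplicity (D.Q p E) (Ideal.span {D.ringElt s})) := by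
  have : Finite (𝓞 F ⧸ h.place.asIdeal) :=
    (D.Q p E).finiteQuotientOfFreeOfNeBot h.prime_Q.ne_zero
  rw [h.place.hilbertSymbol_neg_one_eq_one_iff (h.not_isSquare_neg_one hp4) hS]
  have hS' : D.ringElt s ≠ 0 := fun h0 => hS (congrArg (algebraMap (𝓞 F) F) h0)
  have e : h.place.valuation F (D.elt s) = h.place.intValuation (D.ringElt s) :=
    h.place.valuation_of_algebraMap (D.ringElt s)
  rw [e, HeightOneSpectrum.intValuation_eq_exp_neg_multiplicity _ hS', WithZero.log_exp, even_neg,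
    Int.even_coe_nat]
  rfl

/-! ### Comparison of valuations in `F` and in the subfields -/

theorem multiplicity_ringAut (h : D.IsRamifiedSplit p E) {σ : F ≃ₐ[ℚ] F}
    (hσ : (D.Q p (-E)).map (ringAut σ) = D.Q p E) {x : 𝓞 F} (hx : x ≠ 0) :
    multiplicity (D.Q p E) (Ideal.span {ringAut σ x}) =
      multiplicity (D.Q p (-E)) (Ideal.span {x}) := by
  rw [Ideal.multiplicity_span_map (ringAut_injective σ) h.neg.prime_Q h.prime_Q one_ne_zero
    (I := 1) (by rw [hσ, pow_one, mul_one]) h.prime_Q.not_dvd_one hx, one_mul]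

theorem multiplicity_ringAut_σ₁ (h : D.IsRamifiedSplit p E) {x : 𝓞 F} (hx : x ≠ 0) :
    multiplicity (D.Q p E) (Ideal.span {ringAut D.σ₁ x}) =
      multiplicity (D.Q p (-E)) (Ideal.span {x}) :=
  h.multiplicity_ringAut (by rw [map_σ₁_Q, neg_neg]) hx

theorem multiplicity_ringAut_σ₂ (h : D.IsRamifiedSplit p E) {x : 𝓞 F} (hx : x ≠ 0) :
    multiplicity (D.Q p E) (Ideal.span {ringAut D.σ₂ x}) =
      multiplicity (D.Q p (-E)) (Ideal.span {x}) :=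
  h.multiplicity_ringAut (by rw [map_σ₂_Q, neg_neg]) hx

theorem multiplicity_mul (h : D.IsRamifiedSplit p E) {x y : 𝓞 F} (hx : x ≠ 0) (hy : y ≠ 0) :
    multiplicity (D.Q p E) (Ideal.span {x * y}) =
      multiplicity (D.Q p E) (Ideal.span {x}) + multiplicity (D.Q p E) (Ideal.span {y}) := by
  have hxy : Ideal.span {x} * Ideal.span {y} ≠ 0 := by
    rw [Ideal.span_singleton_mul_span_singleton]
    simpa using ⟨hx, hy⟩
  rw [← Ideal.span_singleton_mul_span_singleton,
    _root_.multiplicity_mul h.prime_Q (FiniteMultiplicity.of_prime_left h.prime_Q hxy)]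

theorem J_ne_top (h : D.IsRamifiedSplit p E) : D.J p ≠ ⊤ := by
  intro ht
  apply span_natCast_ne_top (K := F) h.prime
  rw [← J_sq h.prime h.dvd_a, ht, sq, Ideal.top_mul]

/-- `𝔭` extends to `Q p E * Q p (-E)` with distinct factors, so the ramification index is `1`. -/
theorem multiplicity_of_map_eq_J (h : D.IsRamifiedSplit p E) {K : IntermediateField ℚ F}
    (hK : Module.finrank ℚ K ≤ 2) {𝔭 : Ideal (𝓞 K)} (hmap : 𝔭.map (incl K) = D.J p)
    (h𝔭 : 𝔭 ^ 2 = Ideal.span {(p : 𝓞 K)}) {x : 𝓞 K} (hx : x ≠ 0) :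
    multiplicity (D.Q p E) (Ideal.span {incl K x}) = multiplicity 𝔭 (Ideal.span {x}) := by
  have htop : 𝔭 ≠ ⊤ := by
    rintro rfl
    exact h.J_ne_top (by rw [← hmap, Ideal.map_top])
  have hprime : Prime 𝔭 := prime_of_absNorm_eq_prime h.prime
    (absNorm_eq_of_mul_pow_eq_span h.prime one_ne_zero (by rw [pow_one, ← sq, h𝔭]) hK htop htop).1
  rw [Ideal.multiplicity_span_map (incl_injective K) hprime h.prime_Q one_ne_zero
    (by rw [hmap, ← h.Q_mul_Q_neg, pow_one]) h.not_Q_dvd_Q_neg hx, one_mul]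

theorem multiplicity_𝔭₁ (h : D.IsRamifiedSplit p E) {x : 𝓞 D.F₁} (hx : x ≠ 0) :
    multiplicity (D.Q p E) (Ideal.span {incl D.F₁ x}) =
      multiplicity (D.𝔭₁ p) (Ideal.span {x}) := by
  refine h.multiplicity_of_map_eq_J D.finrank_F₁_le map_𝔭₁ ?_ hx
  have := Ideal.span_pair_sq_eq (Nat.prime_iff_prime_int.mp h.prime) D.squarefree_a h.dvd_a
    D.sq_intA
  rwa [Int.cast_natCast] at this

theorem multiplicity_𝔭₂ (h : D.IsRamifiedSplit p E) (hpb : (p : ℤ) ∣ D.b) {x : 𝓞 D.F₂}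
    (hx : x ≠ 0) :
    multiplicity (D.Q p E) (Ideal.span {incl D.F₂ x}) =
      multiplicity (D.𝔭₂ p) (Ideal.span {x}) := by
  refine h.multiplicity_of_map_eq_J D.finrank_F₂_le
    (map_𝔭₂ h.prime h.dvd_a hpb) ?_ hx
  have := Ideal.span_pair_sq_eq (Nat.prime_iff_prime_int.mp h.prime) D.squarefree_b hpb
    D.sq_intB
  rwa [Int.cast_natCast] at this

/-- The prime `(p, √c + E)` of `F₃` extends to `I p E`, which is `(Q p E)²`: the ramification index
is `2`. -/
theorem multiplicity_span_intC (h : D.IsRamifiedSplit p E) {x : 𝓞 D.F₃} (hx : x ≠ 0) :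
    multiplicity (D.Q p E) (Ideal.span {incl D.F₃ x}) =
      2 * multiplicity (Ideal.span {(p : 𝓞 D.F₃), D.intC + E}) (Ideal.span {x}) := by
  have hmap : ∀ E' : ℤ, (Ideal.span {(p : 𝓞 D.F₃), D.intC + E'}).map (incl D.F₃) = D.I p E' := by
    intro E'
    rw [Ideal.map_span, Set.image_pair, map_natCast, map_add, map_intCast, incl_intC, I]
  have htop : ∀ {E' : ℤ}, D.IsRamifiedSplit p E' →
      Ideal.span {(p : 𝓞 D.F₃), D.intC + E'} ≠ ⊤ := by
    intro E' h' ht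
    have := hmap E'
    rw [ht, Ideal.map_top, ← h'.Q_sq] at this
    exact h'.Q_ne_top (eq_top_iff.mpr (this ▸ Ideal.pow_le_self two_ne_zero))
  have hmul := Ideal.span_pair_add_mul_span_pair_sub h.coprime h.sq_modEq D.sq_intC
  rw [Int.cast_natCast, sub_eq_add_neg, ← Int.cast_neg] at hmul
  have hprime := prime_of_absNorm_eq_prime h.prime (absNorm_eq_of_mul_pow_eq_span h.prime
    one_ne_zero (by rw [pow_one, hmul]) D.finrank_F₃_le (htop h)
    (htop h.neg)).1
  exact Ideal.multiplicity_span_map (incl_injective D.F₃) hprime h.prime_Q two_ne_zero (I := 1)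
    (by rw [hmap, ← h.Q_sq, mul_one]) h.prime_Q.not_dvd_one hx

/-- The contributions of `Q p (-E)` cancel, because both automorphisms exchange the two primes. -/
theorem idealVal_combination (h : D.IsRamifiedSplit p E) (hpb : (p : ℤ) ∣ D.b) {s : Fin 4 → ℤ}
    (hS : D.elt s ≠ 0) :
    (idealVal (D.𝔭₁ p) (D.T₁ s) : ℤ) + (idealVal (D.𝔭₂ p) (D.T₂ s) : ℤ)
        - 2 * (idealVal (Ideal.span {(p : 𝓞 D.F₃), D.intC + E}) (D.T₁₂ s) : ℤ) =
      2 * (multiplicity (D.Q p E) (Ideal.span {D.ringElt s}) : ℤ) := by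
  have hS' : D.ringElt s ≠ 0 := fun h0 => hS (congrArg (algebraMap (𝓞 F) F) h0)
  have hσ : ∀ σ : F ≃ₐ[ℚ] F, ringAut σ (D.ringElt s) ≠ 0 := fun σ =>
    (map_ne_zero_iff _ (ringAut_injective σ)).mpr hS'
  have hne : ∀ {K : IntermediateField ℚ F} {x : 𝓞 K}, incl K x ≠ 0 → x ≠ 0 := by
    rintro K x hx rfl
    exact hx (map_zero _)
  have h1 := h.multiplicity_𝔭₁ (hne (by rw [incl_T₁]; exact mul_ne_zero hS' (hσ _)) :
    D.T₁ s ≠ 0)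
  have h2 := h.multiplicity_𝔭₂ hpb (hne (by rw [incl_T₂]; exact mul_ne_zero hS' (hσ _)) :
    D.T₂ s ≠ 0)
  have h3 := h.multiplicity_span_intC
    (hne (by rw [incl_T₁₂]; exact mul_ne_zero (hσ _) (hσ _)) : D.T₁₂ s ≠ 0)
  rw [incl_T₁, h.multiplicity_mul hS' (hσ _), h.multiplicity_ringAut_σ₁ hS'] at h1
  rw [incl_T₂, h.multiplicity_mul hS' (hσ _), h.multiplicity_ringAut_σ₂ hS'] at h2
  rw [incl_T₁₂, h.multiplicity_mul (hσ _) (hσ _), h.multiplicity_ringAut_σ₁ hS',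
    h.multiplicity_ringAut_σ₂ hS'] at h3
  simp only [idealVal]
  omega

theorem four_dvd_iff (h : D.IsRamifiedSplit p E) (hp4 : p % 4 = 3) (hpb : (p : ℤ) ∣ D.b)
    {s : Fin 4 → ℤ} (hS : D.elt s ≠ 0) :
    (4 : ℤ) ∣ (idealVal (D.𝔭₁ p) (D.T₁ s) : ℤ) + (idealVal (D.𝔭₂ p) (D.T₂ s) : ℤ)
        - 2 * (idealVal (Ideal.span {(p : 𝓞 D.F₃), D.intC + E}) (D.T₁₂ s) : ℤ) ↔
      hilbertSymbol (h.place.adicCompletion F) (-1)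
        (algebraMap F (h.place.adicCompletion F) (D.elt s)) = 1 := by
  rw [h.idealVal_combination hpb hS, h.hilbertSymbol_eq_one_iff hp4 hS, Nat.even_iff]
  omega

/-- `p` is odd, and `p ∣ E` would give `p ∣ c`, against the Legendre symbol being `1`. -/
theorem of_legendreSym (hp : Fact p.Prime) (hp4 : p % 4 = 3) (hpa : (p : ℤ) ∣ D.a)
    (hpc : legendreSym p D.c = 1) (hE : E ^ 2 ≡ D.c [ZMOD p]) : D.IsRamifiedSplit p E where
  prime := hp.out
  dvd_a := hpa
  sq_modEq := hE
  coprime := by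
    refine (Nat.prime_iff_prime_int.mp hp.out).irreducible.coprime_iff_not_dvd.mpr fun hd => ?_
    rcases (Nat.prime_iff_prime_int.mp hp.out).dvd_or_dvd hd with h2 | h2
    · have := (Nat.prime_dvd_prime_iff_eq hp.out Nat.prime_two).mp (by exact_mod_cast h2)
      omega
    · have hc : (p : ℤ) ∣ D.c := by
        have := (Int.ModEq.dvd_iff hE).mp (dvd_pow h2 two_ne_zero)
        exact this
      rw [(legendreSym.eq_zero_iff p D.c).mpr ((ZMod.intCast_zmod_eq_zero_iff_dvd _ _).mpr hc)] at hpc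
      exact zero_ne_one hpc

end IsRamifiedSplit

end

end BiquadraticField

theorem lemma2p2 {F : Type*} [Field F] [NumberField F] (D : BiquadraticField F)
    (s : Fin 4 → ℤ) (hS : D.elt s ≠ 0)
    (p : ℕ) [Fact p.Prime] (hp4 : p % 4 = 3)
    (hpN : ∃ n : ℤ, Algebra.norm ℚ (D.elt s) = (p : ℚ) * (n : ℚ))
    (hpa : (p : ℤ) ∣ D.a) (hpb : (p : ℤ) ∣ D.b)
    (hpc : legendreSym p D.c = 1)
    (C : ℤ) (hC : C ^ 2 ≡ D.c [ZMOD (p : ℤ)]) :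
    {P : HeightOneSpectrum (𝓞 F) | (p : 𝓞 F) ∈ P.asIdeal}.ncard = 2 ∧
    ((∀ P : HeightOneSpectrum (𝓞 F), (p : 𝓞 F) ∈ P.asIdeal →
        hilbertSymbol (P.adicCompletion F) (-1) (algebraMap F (P.adicCompletion F) (D.elt s)) = 1) ↔
      ∀ i ∈ ({1, 2} : Finset ℕ),
        (4 : ℤ) ∣ (idealVal (D.𝔭₁ p) (D.T₁ s) : ℤ) + (idealVal (D.𝔭₂ p) (D.T₂ s) : ℤ)
          - 2 * (idealVal (D.𝔭₃ p C i) (D.T₁₂ s) : ℤ)) := by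
  have h : D.IsRamifiedSplit p C :=
    BiquadraticField.IsRamifiedSplit.of_legendreSym inferInstance hp4 hpa hpc hC
  refine ⟨h.ncard_places, ?_⟩
  -- The sign `(-1)ⁱ` matches `i = 1` with `E = -C` and `i = 2` with `E = C`, which is why the two
  -- conjuncts are swapped at the end.
  have h1 : D.𝔭₃ p C 1 = Ideal.span {(p : 𝓞 D.F₃), D.intC + ((-C : ℤ) : 𝓞 D.F₃)} := by
    simp [BiquadraticField.𝔭₃]
  have h2 : D.𝔭₃ p C 2 = Ideal.span {(p : 𝓞 D.F₃), D.intC + (C : 𝓞 D.F₃)} := by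
    simp [BiquadraticField.𝔭₃]
  simp only [Finset.mem_insert, Finset.mem_singleton, forall_eq_or_imp, forall_eq]
  rw [h1, h2, h.four_dvd_iff hp4 hpb hS, h.neg.four_dvd_iff hp4 hpb hS]
  have hmem : ∀ P : HeightOneSpectrum (𝓞 F), (p : 𝓞 F) ∈ P.asIdeal ↔
      P = h.place ∨ P = h.neg.place := fun P => Set.ext_iff.mp h.setOf_places_eq P
  simp only [hmem, forall_eq_or_imp, forall_eq]
  exact and_comm
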